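/- For each $n$ let $X_1,\dots,X_n$ (which may depend on $n$) be identically distributed, 1-dependent random variables with values in the non-negative integers, where 1-dependent means that the $\sigma$-algebras generated by $X_1,\dots,X_s$ and by $X_t,\dots,X_n$ are independent whenever $1\le s<t\le n$ and $t-s>1$. Put $S_n=X_1+\dots+X_n$, $\nu_1=\mathbb E X_1$, $\nu_2=\mathbb E X_1(X_1-1)$ and $\nu_{1,1}=\max_{1\le k<n}\mathbb E X_kX_{k+1}$ (which is $\mathbb E X_1X_2$ when $\mathbb E X_kX_{k+1}$ does not depend on $k$, for instance for stationary sequences). Let $C_0\ge 1$ be a constant not depending on $n$, let $x=x_n$ be a positive integer, put $$y=\frac{x-n\nu_1}{n\nu_1},\qquad \gamma=\mathrm e^{1.5C_0}\max(\nu_1^2,\nu_2,\nu_{1,1}),$$ and let $Z_n$ be a Poisson random variable with parameter $n\nu_1$. Suppose that, for all sufficiently large $n$, $$X_1\le C_0\ \text{a.s.},\qquad \mathrm e^{5C_0}\nu_1\le 0.002,\qquad |y|\le\tfrac1{10},\qquad \nu_2\le\frac{\nu_1\mathrm e^{-1.5C_0}}{20},\qquad \nu_{1,1}\le\frac{\nu_1\mathrm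 e^{-1.5C_0}}{20},$$ and that, as $n\to\infty$, $$x-n\nu_1=o(\sqrt{n\nu_1}),\qquad \gamma=o(\nu_1),\qquad \nu_1=o(1),\qquad n\nu_1\to\infty.$$ Then $$\frac{\mathbb P(S_n=x)}{\mathbb P(Z_n=x)}=1+o(1)\qquad(n\to\infty).$$ -/

import Mathlib

open MeasureTheory ProbabilityTheory Filter Topology Asymptotics

noncomputable section

namespace LocalPoisson

/-- The finite sequence `X 1, …, X n` is `m`-dependent: whenever `1 ≤ s < t` and `t - s > m`, the
sigma-algebras generated by `X 1, …, X s` and by `X t, …, X n` are independent. -/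
def IsMDependent {Ω : Type*} [MeasurableSpace Ω] (m n : ℕ) (X : ℕ → Ω → ℕ) (μ : Measure Ω) :
    Prop :=
  ∀ s t : ℕ, 1 ≤ s → s + m < t →
    Indep (⨆ i ∈ Finset.Icc 1 s, MeasurableSpace.comap (X i) inferInstance)
      (⨆ j ∈ Finset.Icc t n, MeasurableSpace.comap (X j) inferInstance) μ

/-- The mean `ν₁ = E X₁`. -/
def nu1 {Ω : Type*} [MeasurableSpace Ω] (X : ℕ → Ω → ℕ) (μ : Measure Ω) : ℝ :=
  ∫ ω, (X 1 ω : ℝ) ∂μ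

/-- The second factorial moment `ν₂ = E X₁ (X₁ - 1)`. -/
def nu2 {Ω : Type*} [MeasurableSpace Ω] (X : ℕ → Ω → ℕ) (μ : Measure Ω) : ℝ :=
  ∫ ω, (X 1 ω : ℝ) * ((X 1 ω : ℝ) - 1) ∂μ

/-- The largest mixed moment of two neighbours, `max_{1 ≤ k < n} E X_k X_{k+1}` (and `0` if there
are no neighbours). It is `E X₁ X₂` as soon as `E X_k X_{k+1}` does not depend on `k`. -/
def nu11 {Ω : Type*} [MeasurableSpace Ω] (n : ℕ) (X : ℕ → Ω → ℕ) (μ : Measure Ω) : ℝ :=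
  ⨆ k : Finset.Ico 1 n, ∫ ω, (X k ω : ℝ) * (X (k + 1) ω : ℝ) ∂μ

/-- `γ = exp(1.5 C₀) max(ν₁², ν₂, max_k E X_k X_{k+1})`. -/
def gam {Ω : Type*} [MeasurableSpace Ω] (C₀ : ℝ) (n : ℕ) (X : ℕ → Ω → ℕ) (μ : Measure Ω) : ℝ :=
  Real.exp (1.5 * C₀) * max (nu1 X μ ^ 2) (max (nu2 X μ) (nu11 n X μ))

/-- `y = (x - n ν₁) / (n ν₁)`. -/
def relDev {Ω : Type*} [MeasurableSpace Ω] (n : ℕ) (X : ℕ → Ω → ℕ) (μ : Measure Ω) (x : ℕ) : ℝ :=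
  ((x : ℝ) - n * nu1 X μ) / (n * nu1 X μ)

/-- The standing assumptions on `X 1, …, X n` and the positive integer `x`: identically distributed
1-dependent random variables with values in the non-negative integers, subject to the bounds below.
-/
structure Setting {Ω : Type*} [MeasurableSpace Ω] (C₀ : ℝ) (n : ℕ) (X : ℕ → Ω → ℕ)
    (μ : Measure Ω) (x : ℕ) : Prop where
  measurable : ∀ k ∈ Finset.Icc 1 n, Measurable (X k)
  identDistrib : ∀ k ∈ Finset.Icc 1 n, IdentDistrib (X k) (X 1) μ μ
  oneDependent : IsMDependent 1 n X μ
  x_pos : 0 < x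
  bounded : ∀ᵐ ω ∂μ, (X 1 ω : ℝ) ≤ C₀
  nu1_le : Real.exp (5 * C₀) * nu1 X μ ≤ 0.002
  relDev_le : |relDev n X μ x| ≤ 1 / 10
  nu2_le : nu2 X μ ≤ nu1 X μ * Real.exp (-1.5 * C₀) / 20
  nu11_le : nu11 n X μ ≤ nu1 X μ * Real.exp (-1.5 * C₀) / 20

/-- `P(S_n = x)` for `S_n = X 1 + ⋯ + X n`. -/
def probSum {Ω : Type*} [MeasurableSpace Ω] (n : ℕ) (X : ℕ → Ω → ℕ) (μ : Measure Ω) (x : ℕ) : ℝ :=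
  μ.real {ω | ∑ k ∈ Finset.Icc 1 n, X k ω = x}

/-- `P(Z_n = x)` for a Poisson random variable `Z_n` with parameter `n ν₁` (which is `≥ 0`). -/
def probPoisson {Ω : Type*} [MeasurableSpace Ω] (n : ℕ) (X : ℕ → Ω → ℕ) (μ : Measure Ω) (x : ℕ) :
    ℝ :=
  (poissonMeasure (n * nu1 X μ).toNNReal).real {x}

end LocalPoisson

end

/-! On the unit circle the generating function `E u^(S_n)` is compared with the Poisson one, `exp (n
ν₁ (u - 1))`, by Heinrich's method. Expanding `u^(X_i) = 1 + (u^(X_i) - 1)` backwards from the last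
index, and using independence across a gap of one index, gives a recursion for `E u^(S_j)`
(`integral_prod_succ`). Its weights are expectations of products of `u^(X_i) - 1` over blocks, and
these decay geometrically in the block length (`integral_prod_le_geometric`). Hence each new
variable multiplies the generating function by `1 + E (u^(X_1) - 1)`, and so by `exp (ν₁ (u - 1))`,
up to a relative error `O(G |u - 1|²)`, where `G` is `maxMoment` (`norm_recursion_sub_le`,
`Setting.norm_step_le`).

Since `|exp (ν₁ (u - 1))| = exp (-ν₁ |u - 1|² / 2)`, a small `G / ν₁` lets this decay dominate the
error. After `n` steps the difference is `O(G / ν₁)` times a Gaussian factor in `√(n ν₁) |u - 1|`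
(`Setting.norm_genFun_sub_le`). Fourier inversion then bounds the difference of the point
probabilities by `O((G / ν₁) / √(n ν₁))`. Within one standard deviation of its mean the Poisson
probability is at least a constant over `√(n ν₁)` (`le_poissonMeasure_real_singleton`), so the ratio
is `1 + O(G / ν₁)`. -/

namespace LocalPoisson

/-! ### Perturbed linear recursions, and powers on the unit circle -/

/-- If `F` grows by a factor within `1/2` of `1` at each step up to `j`, then earlier values are
dominated by powers of `2` times later ones. -/
lemma norm_le_two_pow_mul_norm {F : ℕ → ℂ} {j : ℕ}
    (h : ∀ i < j, ‖F (i + 1) - F i‖ ≤ 1 / 2 * ‖F i‖) (i d : ℕ) (hid : i + d ≤ j) :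
    ‖F i‖ ≤ 2 ^ d * ‖F (i + d)‖ := by
  induction d with
  | zero => simp
  | succ d ih =>
    have h1 := ih (by omega)
    have h2 := h (i + d) (by omega)
    have h3 : ‖F (i + d)‖ ≤ 2 * ‖F (i + d + 1)‖ := by
      have := norm_sub_norm_le (F (i + d)) (F (i + d + 1))
      rw [norm_sub_rev] at this
      linarith
    calc ‖F i‖ ≤ 2 ^ d * ‖F (i + d)‖ := h1
      _ ≤ 2 ^ d * (2 * ‖F (i + d + 1)‖) := by gcongr
      _ = 2 ^ (d + 1) * ‖F (i + (d + 1))‖ := by rw [pow_succ, ← add_assoc]; ring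

/-- The contribution of the long blocks to the recursion is of order `b`. -/
lemma norm_sum_tail_le {F : ℕ → ℂ} {w : ℕ → ℂ} {j : ℕ} {b : ℝ}
    (hb : 0 ≤ b) (h : ∀ i < j + 1, ‖F (i + 1) - F i‖ ≤ 1 / 2 * ‖F i‖)
    (hw : ∀ m i, m + i + 1 = j → ‖w m‖ ≤ b * (1 / 4) ^ i) :
    ‖∑ m ∈ Finset.range j, F m * w m‖ ≤ 8 * b * ‖F (j + 1)‖ := by
  -- After reflection `i` measures the distance from the end: the growth bound loses `2 ^ (i + 2)`,
  -- the weight gains `(1 / 4) ^ i`, and a geometric series of ratio `1 / 2` remains.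
  rw [← Finset.sum_range_reflect]
  calc ‖∑ i ∈ Finset.range j, F (j - 1 - i) * w (j - 1 - i)‖
      ≤ ∑ i ∈ Finset.range j, 4 * b * ‖F (j + 1)‖ * (1 / 2) ^ i := by
        refine norm_sum_le_of_le _ fun i hi => ?_
        have hi' := Finset.mem_range.1 hi
        have h1 := norm_le_two_pow_mul_norm h (j - 1 - i) (i + 2) (by omega)
        rw [show j - 1 - i + (i + 2) = j + 1 by omega] at h1
        have h2 := hw (j - 1 - i) i (by omega)
        rw [norm_mul]
        calc _ ≤ (2 ^ (i + 2) * ‖F (j + 1)‖) * (b * (1 / 4) ^ i) := by gcongr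
          _ = _ := by
            rw [show (1 / 4 : ℝ) = 1 / 2 * (1 / 2) by norm_num, mul_pow, pow_add]
            have : (2 : ℝ) ^ i * (1 / 2) ^ i = 1 := by rw [← mul_pow]; norm_num
            linear_combination (4 * b * ‖F (j + 1)‖ * (1 / 2) ^ i) * this
    _ = 4 * b * ‖F (j + 1)‖ * ∑ i ∈ Finset.range j, (1 / 2) ^ i := by rw [Finset.mul_sum]
    _ ≤ 4 * b * ‖F (j + 1)‖ * 2 := by
        gcongr
        exact sum_geometric_two_le j
    _ = 8 * b * ‖F (j + 1)‖ := by ring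

/-- Heinrich's recursion: the ratio of consecutive values of `F` is close to `1 + w₀`. -/
theorem norm_recursion_sub_le {F : ℕ → ℂ} {w : ℕ → ℕ → ℂ} {n : ℕ} {a b : ℝ} {w₀ : ℂ}
    (hb : 0 ≤ b) (hab : 2 * a + 8 * b ≤ 1 / 2)
    (hF : F 1 = F 0)
    (hrec : ∀ j < n, F (j + 2) = F (j + 1) + ∑ m ∈ Finset.range (j + 1), F m * w m (j + 1))
    (hw₀ : ‖w₀‖ ≤ a) (hw₁ : ∀ j < n, w j (j + 1) = w₀)
    (hw₂ : ∀ m i, m + i + 2 ≤ n → ‖w m (m + i + 2)‖ ≤ b * (1 / 4) ^ i) :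
    ∀ j < n, ‖F (j + 2) - (1 + w₀) * F (j + 1)‖ ≤
      (2 * a * (2 * a + 8 * b) + 8 * b) * ‖F (j + 1)‖ := by
  have ha : 0 ≤ a := (norm_nonneg _).trans hw₀
  have htail : ∀ j < n, (∀ i < j + 1, ‖F (i + 1) - F i‖ ≤ 1 / 2 * ‖F i‖) →
      ‖∑ m ∈ Finset.range j, F m * w m (j + 1)‖ ≤ 8 * b * ‖F (j + 1)‖ := by
    intro j hj h
    refine norm_sum_tail_le hb h fun m i hm => ?_
    subst hm
    exact hw₂ m i hj
  have hhalf : ∀ {i : ℕ}, ‖F (i + 1) - F i‖ ≤ (2 * a + 8 * b) * ‖F i‖ →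
      ‖F (i + 1) - F i‖ ≤ 1 / 2 * ‖F i‖ := fun h =>
    h.trans (mul_le_mul_of_nonneg_right hab (norm_nonneg _))
  -- A coarse bound comes first, by strong induction: `hab` turns it into the factor `1 / 2` at all
  -- earlier steps, which is what the tail estimate needs at the next one.
  have hstep : ∀ j ≤ n, ‖F (j + 1) - F j‖ ≤ (2 * a + 8 * b) * ‖F j‖ := by
    intro j
    induction j using Nat.strong_induction_on with
    | _ j ih =>
      intro hj
      rcases j with _ | j
      · rw [zero_add, hF, sub_self, norm_zero]; positivity
      have hsmall : ∀ i < j + 1, ‖F (i + 1) - F i‖ ≤ 1 / 2 * ‖F i‖ := fun i hi =>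
        hhalf (ih i hi (by omega))
      have h1 := htail j hj hsmall
      have h2 := norm_le_two_pow_mul_norm hsmall j 1 le_rfl
      rw [pow_one] at h2
      rw [hrec j hj, add_sub_cancel_left, Finset.sum_range_succ, hw₁ j hj]
      calc _ ≤ 8 * b * ‖F (j + 1)‖ + ‖F j‖ * ‖w₀‖ :=
            (norm_add_le _ _).trans (by rw [norm_mul]; gcongr)
        _ ≤ 8 * b * ‖F (j + 1)‖ + (2 * ‖F (j + 1)‖) * a := by gcongr
        _ = _ := by ring
  intro j hj
  have hsmall : ∀ i < j + 1, ‖F (i + 1) - F i‖ ≤ 1 / 2 * ‖F i‖ := fun i hi =>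
    hhalf (hstep i (by omega))
  have h1 := htail j hj hsmall
  have h2 := norm_le_two_pow_mul_norm hsmall j 1 le_rfl
  rw [pow_one] at h2
  have h3 := hstep j hj.le
  -- The main term of the recursion carries `F j` instead of `F (j + 1)`; by the coarse bound the
  -- exchange costs only a product of two small quantities.
  have : F (j + 2) - (1 + w₀) * F (j + 1) =
      ∑ m ∈ Finset.range j, F m * w m (j + 1) - w₀ * (F (j + 1) - F j) := by
    rw [hrec j hj, Finset.sum_range_succ, hw₁ j hj]; ring
  rw [this]
  calc _ ≤ 8 * b * ‖F (j + 1)‖ + a * ((2 * a + 8 * b) * (2 * ‖F (j + 1)‖)) := by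
        refine (norm_sub_le _ _).trans ?_
        rw [norm_mul]
        gcongr
        exact h3.trans (by gcongr)
    _ = _ := by ring

/-- If each step of `F` is multiplication by `r` up to a relative error `δ`, then `F (n + 1)` is
`r ^ n` up to `n δ (‖r‖ + δ) ^ (n - 1)`. -/
theorem norm_sub_pow_le {F : ℕ → ℂ} {n : ℕ} {r : ℂ} {R δ : ℝ} (hδ : 0 ≤ δ) (hR : ‖r‖ + δ ≤ R)
    (h1 : F 1 = 1) (hstep : ∀ j < n, ‖F (j + 2) - r * F (j + 1)‖ ≤ δ * ‖F (j + 1)‖) :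
    ‖F (n + 1) - r ^ n‖ ≤ n * δ * R ^ (n - 1) := by
  have hR0 : 0 ≤ R := (add_nonneg (norm_nonneg r) hδ).trans hR
  have hF : ∀ j ≤ n, ‖F (j + 1)‖ ≤ R ^ j := by
    intro j hj
    induction j with
    | zero => simp [h1]
    | succ j ih =>
      have h2 := hstep j hj
      have h3 := ih (by omega)
      have h4 := norm_add_le (F (j + 2) - r * F (j + 1)) (r * F (j + 1))
      rw [sub_add_cancel, norm_mul] at h4
      calc ‖F (j + 1 + 1)‖ ≤ (‖r‖ + δ) * ‖F (j + 1)‖ := by linarith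
        _ ≤ R * R ^ j := by gcongr
        _ = R ^ (j + 1) := by ring
  induction n with
  | zero => simp [h1]
  | succ n ih =>
    have h2 := hstep n (by omega)
    have h3 := ih (fun j hj => hstep j (by omega)) (fun j hj => hF j (by omega))
    have h4 := hF n (by omega)
    -- The case `n = 0` is separate because the exponent `n - 1` is truncated there.
    have h5 : ‖r‖ * (n * δ * R ^ (n - 1)) ≤ n * δ * R ^ n := by
      rcases n with _ | n
      · simp
      · have : ‖r‖ ≤ R := by linarith
        calc _ ≤ R * ((n + 1 : ℕ) * δ * R ^ (n + 1 - 1)) := by gcongr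
          _ = _ := by rw [Nat.add_sub_cancel]; ring
    calc ‖F (n + 1 + 1) - r ^ (n + 1)‖
        = ‖(F (n + 2) - r * F (n + 1)) + r * (F (n + 1) - r ^ n)‖ := by congr 1; ring
      _ ≤ δ * ‖F (n + 1)‖ + ‖r‖ * (n * δ * R ^ (n - 1)) := by
          refine (norm_add_le _ _).trans ?_
          rw [norm_mul]; gcongr
      _ ≤ δ * R ^ n + n * δ * R ^ n := by gcongr
      _ = _ := by rw [Nat.add_sub_cancel]; push_cast; ring

/-- Second order expansion of a power on the unit circle. -/
lemma norm_pow_sub_one_sub_le {u : ℂ} (hu : ‖u‖ = 1) (N : ℕ) :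
    ‖u ^ N - 1 - N * (u - 1)‖ ≤ (N : ℝ) * (N - 1) / 2 * ‖u - 1‖ ^ 2 ∧
      ‖u ^ N - 1‖ ≤ N * ‖u - 1‖ := by
  induction N with
  | zero => simp
  | succ N ih =>
    constructor
    · calc _ = ‖(u ^ N - 1 - N * (u - 1)) + (u ^ N - 1) * (u - 1)‖ := by
            congr 1; push_cast; ring
        _ ≤ (N : ℝ) * (N - 1) / 2 * ‖u - 1‖ ^ 2 + (N * ‖u - 1‖) * ‖u - 1‖ := by
            refine (norm_add_le _ _).trans ?_
            rw [norm_mul]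
            gcongr
            exacts [ih.1, ih.2]
        _ = _ := by push_cast; ring
    · calc _ = ‖u * (u ^ N - 1) + (u - 1)‖ := by congr 1; ring
        _ ≤ 1 * (N * ‖u - 1‖) + ‖u - 1‖ := by
            refine (norm_add_le _ _).trans ?_
            rw [norm_mul, hu]
            gcongr
            exact ih.2
        _ = _ := by push_cast; ring

/-! ### Block products under 1-dependence -/

lemma norm_prod_le_pow_card {ι 𝕜 : Type*} [RCLike 𝕜] (s : Finset ι) (c : ι → 𝕜) {C : ℝ}
    (hc : ∀ i ∈ s, ‖c i‖ ≤ C) : ‖∏ i ∈ s, c i‖ ≤ C ^ s.card := by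
  rw [norm_prod]
  exact (Finset.prod_le_prod (fun _ _ => norm_nonneg _) hc).trans_eq (by simp)

lemma measurable_prod_comap {Ω 𝕜 : Type*} [RCLike 𝕜] {X : ℕ → Ω → ℕ} (f : ℕ → 𝕜) {a b c d : ℕ} (hca : c ≤ a)
    (hbd : b ≤ d) :
    Measurable[⨆ i ∈ Finset.Icc c d, MeasurableSpace.comap (X i) inferInstance]
      fun ω => ∏ i ∈ Finset.Icc a b, f (X i ω) := by
  refine Finset.measurable_fun_prod _ fun i hi => ?_
  have hi' : i ∈ Finset.Icc c d := Finset.Icc_subset_Icc hca hbd hi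
  have : Measurable[MeasurableSpace.comap (X i) inferInstance] fun ω => f (X i ω) :=
    (measurable_from_top (f := f)).comp (comap_measurable (X i))
  exact this.mono (le_iSup₂ (f := fun i (_ : i ∈ Finset.Icc c d) =>
    MeasurableSpace.comap (X i) inferInstance) i hi') le_rfl

section Blocks

variable {Ω : Type*} [MeasurableSpace Ω] {μ : Measure Ω} [IsProbabilityMeasure μ]
  {n : ℕ} {X : ℕ → Ω → ℕ}

/-- Allows `s = 0`, where the left sigma-algebra is trivial; empty leading blocks occur at the start
of the expansion. -/
lemma IsMDependent.indep_of_lt (h : IsMDependent 1 n X μ) {s t : ℕ} (hst : s + 1 < t) :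
    Indep (⨆ i ∈ Finset.Icc 1 s, MeasurableSpace.comap (X i) inferInstance)
      (⨆ j ∈ Finset.Icc t n, MeasurableSpace.comap (X j) inferInstance) μ := by
  rcases Nat.eq_zero_or_pos s with rfl | hs
  · simpa using indep_bot_left _
  · exact h s t hs hst

lemma measurable_prod_block {𝕜 : Type*} [RCLike 𝕜] (hX : ∀ k ∈ Finset.Icc 1 n, Measurable (X k))
    (f : ℕ → 𝕜) {a b : ℕ} (ha : 1 ≤ a) (hb : b ≤ n) :
    Measurable fun ω => ∏ i ∈ Finset.Icc a b, f (X i ω) :=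
  Finset.measurable_fun_prod _ fun i hi =>
    (measurable_from_top (f := f)).comp (hX i (Finset.Icc_subset_Icc ha hb hi))

lemma integrable_prod_block {𝕜 : Type*} [RCLike 𝕜] (hX : ∀ k ∈ Finset.Icc 1 n, Measurable (X k))
    (f : ℕ → 𝕜) {C : ℝ} (hf : ∀ N, ‖f N‖ ≤ C) {a b : ℕ} (ha : 1 ≤ a) (hb : b ≤ n) :
    Integrable (fun ω => ∏ i ∈ Finset.Icc a b, f (X i ω)) μ := by
  refine Integrable.of_bound (measurable_prod_block hX f ha hb).aestronglyMeasurable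
    (C ^ (Finset.Icc a b).card) (ae_of_all _ fun ω => ?_)
  exact norm_prod_le_pow_card _ _ fun i _ => hf _

/-- Products over blocks of indices that are at distance at least two have independent
expectations. -/
theorem IsMDependent.integral_mul_block {𝕜 : Type*} [RCLike 𝕜] (h : IsMDependent 1 n X μ)
    (hX : ∀ k ∈ Finset.Icc 1 n, Measurable (X k)) (f g : ℕ → 𝕜) {a s t k : ℕ}
    (ha : 1 ≤ a) (hst : s + 1 < t) (hs : s ≤ n) (hk : k ≤ n) :
    ∫ ω, (∏ i ∈ Finset.Icc a s, f (X i ω)) * ∏ i ∈ Finset.Icc t k, g (X i ω) ∂μ =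
      (∫ ω, ∏ i ∈ Finset.Icc a s, f (X i ω) ∂μ) * ∫ ω, ∏ i ∈ Finset.Icc t k, g (X i ω) ∂μ := by
  refine IndepFun.integral_fun_mul_eq_mul_integral ?_
    (measurable_prod_block hX f ha hs).aestronglyMeasurable
    (measurable_prod_block hX g (by omega) hk).aestronglyMeasurable
  rw [IndepFun_iff_Indep]
  exact indep_of_indep_of_le (h.indep_of_lt hst)
    (measurable_prod_comap f ha le_rfl).comap_le (measurable_prod_comap g le_rfl hk).comap_le

/-- Telescoping expansion of `E ∏_{i ≤ m} f(X_i) ∏_{m < i ≤ k} (f(X_i) - 1)`. -/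
lemma integral_prod_mul_prod_sub_one (h : IsMDependent 1 n X μ)
    (hX : ∀ k ∈ Finset.Icc 1 n, Measurable (X k)) (f : ℕ → ℂ) {C : ℝ} (hf : ∀ N, ‖f N‖ ≤ C)
    {k m : ℕ} (hk : k ≤ n) (hm : m < k) :
    ∫ ω, (∏ i ∈ Finset.Icc 1 m, f (X i ω)) * ∏ i ∈ Finset.Icc (m + 1) k, (f (X i ω) - 1) ∂μ =
      ∑ l ∈ Finset.range (m + 1), (∫ ω, ∏ i ∈ Finset.Icc 1 (l - 1), f (X i ω) ∂μ) *
        ∫ ω, ∏ i ∈ Finset.Icc (l + 1) k, (f (X i ω) - 1) ∂μ := by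
  have hf1 : ∀ N, ‖f N - 1‖ ≤ C + 1 := fun N => by
    simpa using (norm_sub_le (f N) 1).trans (add_le_add_left (hf N) _)
  induction m with
  | zero => simp
  | succ m ih =>
    -- Writing `f(X_{m+1}) = 1 + (f(X_{m+1}) - 1)`, the second summand gives the expression for `m`.
    -- In the first, index `m + 1` has disappeared, and this gap makes the expectation factorise.
    rw [Finset.sum_range_succ, ← ih (by omega), Nat.add_sub_cancel,
      ← h.integral_mul_block hX f (fun N => f N - 1) le_rfl (by omega) (by omega) hk,
      ← integral_add]
    · congr 1
      ext ω
      rw [Finset.prod_Icc_succ_top (by omega), ← Finset.mul_prod_Ioc_eq_prod_Icc (a := m + 1)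
        (by omega), show Finset.Ioc (m + 1) k = Finset.Icc (m + 1 + 1) k by ext; simp]
      ring
    · refine (integrable_prod_block hX f hf le_rfl (by omega)).mul_bdd
        (c := (C + 1) ^ (Finset.Icc (m + 1) k).card)
        (measurable_prod_block hX (fun N => f N - 1) (by omega) hk).aestronglyMeasurable
        (ae_of_all _ fun ω => ?_)
      exact norm_prod_le_pow_card _ _ fun i _ => hf1 _
    · refine (integrable_prod_block hX f hf le_rfl (by omega)).mul_bdd
        (c := (C + 1) ^ (Finset.Icc (m + 1 + 1) k).card)
        (measurable_prod_block hX (fun N => f N - 1) (by omega) hk).aestronglyMeasurable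
        (ae_of_all _ fun ω => ?_)
      exact norm_prod_le_pow_card _ _ fun i _ => hf1 _

/-- Split the last factor as `1 + (f - 1)` and telescope. Because `l - 1` is truncated, `l = 0` and
`l = 1` both have an empty leading product; the term `l = 0` is the one where the block reaches back
to the first index. -/
theorem integral_prod_succ (h : IsMDependent 1 n X μ)
    (hX : ∀ k ∈ Finset.Icc 1 n, Measurable (X k)) (f : ℕ → ℂ) {C : ℝ} (hf : ∀ N, ‖f N‖ ≤ C)
    {j : ℕ} (hj : j < n) :
    ∫ ω, ∏ i ∈ Finset.Icc 1 (j + 1), f (X i ω) ∂μ = ∫ ω, ∏ i ∈ Finset.Icc 1 j, f (X i ω) ∂μ +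
      ∑ l ∈ Finset.range (j + 1), (∫ ω, ∏ i ∈ Finset.Icc 1 (l - 1), f (X i ω) ∂μ) *
        ∫ ω, ∏ i ∈ Finset.Icc (l + 1) (j + 1), (f (X i ω) - 1) ∂μ := by
  have hf1 : ∀ N, ‖f N - 1‖ ≤ C + 1 := fun N => by
    simpa using (norm_sub_le (f N) 1).trans (add_le_add_left (hf N) _)
  rw [← integral_prod_mul_prod_sub_one h hX f hf hj (Nat.lt_succ_self j), ← integral_add]
  · congr 1
    ext ω
    rw [Finset.prod_Icc_succ_top (by omega)]
    simp only [Finset.Icc_self, Finset.prod_singleton]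
    ring
  · exact integrable_prod_block hX f hf le_rfl hj.le
  · refine (integrable_prod_block hX f hf le_rfl hj.le).mul_bdd
      (c := (C + 1) ^ (Finset.Icc (j + 1) (j + 1)).card)
      (measurable_prod_block hX (fun N => f N - 1) (by omega) hj).aestronglyMeasurable
      (ae_of_all _ fun ω => ?_)
    exact norm_prod_le_pow_card _ _ fun i _ => hf1 _

/-- Dropping the first two factors of a block. -/
lemma integral_prod_norm_le (h : IsMDependent 1 n X μ)
    (hX : ∀ k ∈ Finset.Icc 1 n, Measurable (X k)) (g : ℕ → ℝ) (hg0 : ∀ N, 0 ≤ g N)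
    {C : ℝ} (hg : ∀ N, g N ≤ C) {m k : ℕ} (hm : m + 2 ≤ k) (hk : k ≤ n) :
    ∫ ω, ∏ i ∈ Finset.Icc (m + 1) k, g (X i ω) ∂μ ≤
      C * (∫ ω, g (X (m + 1) ω) ∂μ) * ∫ ω, ∏ i ∈ Finset.Icc (m + 3) k, g (X i ω) ∂μ := by
  have hgn : ∀ N, ‖g N‖ ≤ C := fun N => by rw [Real.norm_of_nonneg (hg0 N)]; exact hg N
  -- Bounding the factor at `m + 2` by `C` creates the gap that separates `m + 1` from the block
  -- starting at `m + 3`.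
  have key := h.integral_mul_block hX g g (a := m + 1) (s := m + 1) (t := m + 3) (k := k)
    (by omega) (by omega) (by omega) hk
  simp only [Finset.Icc_self, Finset.prod_singleton] at key
  rw [mul_assoc, ← key, ← integral_const_mul]
  refine integral_mono (integrable_prod_block hX g hgn (by omega) hk) ?_ fun ω => ?_
  · refine Integrable.const_mul ?_ C
    refine (integrable_prod_block hX g hgn (by omega) hk).bdd_mul (c := C)
      ?_ (ae_of_all _ fun ω => hgn _)
    exact ((measurable_from_top (f := g)).comp
      (hX (m + 1) (Finset.mem_Icc.2 ⟨by omega, by omega⟩))).aestronglyMeasurable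
  · have e1 : Finset.Ioc (m + 1) k = Finset.Icc (m + 2) k := by ext; simp; omega
    have e2 : Finset.Ioc (m + 2) k = Finset.Icc (m + 3) k := by ext; simp; omega
    beta_reduce
    rw [← Finset.mul_prod_Ioc_eq_prod_Icc (a := m + 1) (by omega), e1,
      ← Finset.mul_prod_Ioc_eq_prod_Icc (a := m + 2) hm, e2]
    have h1 : 0 ≤ ∏ i ∈ Finset.Icc (m + 3) k, g (X i ω) := Finset.prod_nonneg fun _ _ => hg0 _
    have h2 := hg (X (m + 2) ω)
    have h3 := hg0 (X (m + 1) ω)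
    calc _ = g (X (m + 2) ω) * (g (X (m + 1) ω) * ∏ i ∈ Finset.Icc (m + 3) k, g (X i ω)) := by ring
      _ ≤ _ := by gcongr

/-- Geometric decay of the mixed moments of blocks. -/
theorem integral_prod_le_geometric (h : IsMDependent 1 n X μ)
    (hX : ∀ k ∈ Finset.Icc 1 n, Measurable (X k)) (g : ℕ → ℝ) (hg0 : ∀ N, 0 ≤ g N)
    (hg : ∀ N, g N ≤ 2) {a b : ℝ} (ha : a ≤ 1 / 32) (hab : 8 * a ^ 2 ≤ b)
    (hg1 : ∀ k ∈ Finset.Icc 1 n, ∫ ω, g (X k ω) ∂μ ≤ a)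
    (hg2 : ∀ k ∈ Finset.Ico 1 n, ∫ ω, g (X k ω) * g (X (k + 1) ω) ∂μ ≤ b) (i m : ℕ)
    (him : m + i + 2 ≤ n) :
    ∫ ω, ∏ l ∈ Finset.Icc (m + 1) (m + i + 2), g (X l ω) ∂μ ≤ b * (1 / 4) ^ i := by
  have hpos : ∀ k, 0 ≤ ∫ ω, g (X k ω) ∂μ := fun k => integral_nonneg fun ω => hg0 _
  -- Two indices are removed at a time, at the cost `2 * (1 / 32) = (1 / 4) ^ 2`. Blocks of length
  -- two are covered by `hg2`; those of length three give `2 * a ^ 2 ≤ b / 4`, whence the hypothesis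
  -- `hab`.
  induction i using Nat.twoStepInduction generalizing m with
  | zero =>
    have h1 := hg2 (m + 1) (Finset.mem_Ico.2 ⟨by omega, by omega⟩)
    have e : Finset.Icc (m + 1) (m + 0 + 2) = {m + 1, m + 2} := by ext; simp; omega
    rw [e]
    simpa using h1
  | one =>
    have h1 := integral_prod_norm_le h hX g hg0 hg (m := m) (k := m + 1 + 2) (by omega) him
    have h2 := hg1 (m + 1) (Finset.mem_Icc.2 ⟨by omega, by omega⟩)
    have h3 := hg1 (m + 3) (Finset.mem_Icc.2 ⟨by omega, by omega⟩)
    rw [show m + 1 + 2 = m + 3 by omega] at h1 ⊢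
    simp only [Finset.Icc_self, Finset.prod_singleton] at h1
    have h4 := hpos (m + 1)
    have h5 := hpos (m + 3)
    nlinarith [mul_le_mul h2 h3 h5 (h4.trans h2)]
  | more i ih _ =>
    have h1 := integral_prod_norm_le h hX g hg0 hg (m := m) (k := m + (i + 2) + 2) (by omega) him
    have h2 := hg1 (m + 1) (Finset.mem_Icc.2 ⟨by omega, by omega⟩)
    have h3 := ih (m + 2) (by omega)
    rw [show m + 2 + i + 2 = m + (i + 2) + 2 by omega, show m + 2 + 1 = m + 3 by omega] at h3
    have h4 : 0 ≤ ∫ ω, ∏ l ∈ Finset.Icc (m + 3) (m + (i + 2) + 2), g (X l ω) ∂μ :=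
      integral_nonneg fun ω => Finset.prod_nonneg fun _ _ => hg0 _
    have h5 := hpos (m + 1)
    calc _ ≤ _ := h1
      _ ≤ 2 * (1 / 32) * (b * (1 / 4) ^ i) := by
        gcongr
        exact h2.trans ha
      _ = _ := by ring

end Blocks

/-! ### Moment bounds and the generating function on the unit circle -/

/-- `max(ν₁², ν₂, max_k E X_k X_{k+1})`. -/
noncomputable def maxMoment {Ω : Type*} [MeasurableSpace Ω] (n : ℕ) (X : ℕ → Ω → ℕ)
    (μ : Measure Ω) : ℝ :=
  max (nu1 X μ ^ 2) (max (nu2 X μ) (nu11 n X μ))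

section Moments

variable {Ω : Type*} [MeasurableSpace Ω] {μ : Measure Ω}
  {n : ℕ} {X : ℕ → Ω → ℕ} {C₀ : ℝ} {x : ℕ}

lemma Setting.ae_le (h : Setting C₀ n X μ x) {k : ℕ} (hk : k ∈ Finset.Icc 1 n) :
    ∀ᵐ ω ∂μ, (X k ω : ℝ) ≤ C₀ :=
  (h.identDistrib k hk).symm.ae_snd (p := fun N : ℕ => (N : ℝ) ≤ C₀)
    (MeasurableSet.of_discrete) h.bounded

lemma Setting.integral_comp_eq (h : Setting C₀ n X μ x) {E : Type*} [NormedAddCommGroup E]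
    [NormedSpace ℝ E] [MeasurableSpace E] [BorelSpace E] (f : ℕ → E) {k : ℕ}
    (hk : k ∈ Finset.Icc 1 n) :
    ∫ ω, f (X k ω) ∂μ = ∫ ω, f (X 1 ω) ∂μ :=
  ((h.identDistrib k hk).comp (measurable_from_top (f := f))).integral_eq

lemma Setting.measurable_comp (h : Setting C₀ n X μ x) {E : Type*} [MeasurableSpace E]
    (f : ℕ → E) {k : ℕ} (hk : k ∈ Finset.Icc 1 n) : Measurable fun ω => f (X k ω) :=
  (measurable_from_top (f := f)).comp (h.measurable k hk)

lemma integral_mul_le_nu11 {k : ℕ} (hk : k ∈ Finset.Ico 1 n) :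
    ∫ ω, (X k ω : ℝ) * (X (k + 1) ω : ℝ) ∂μ ≤ nu11 n X μ :=
  le_ciSup (f := fun k : Finset.Ico 1 n => ∫ ω, (X k ω : ℝ) * (X (k + 1) ω : ℝ) ∂μ)
    (Set.finite_range _).bddAbove ⟨k, hk⟩

lemma nu1_nonneg : 0 ≤ nu1 X μ := integral_nonneg fun _ => Nat.cast_nonneg _

lemma maxMoment_nonneg : 0 ≤ maxMoment n X μ := (sq_nonneg _).trans (le_max_left _ _)

variable [IsProbabilityMeasure μ]

lemma Setting.integrable (h : Setting C₀ n X μ x) {k : ℕ} (hk : k ∈ Finset.Icc 1 n) :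
    Integrable (fun ω => (X k ω : ℝ)) μ := by
  refine Integrable.of_bound (h.measurable_comp _ hk).aestronglyMeasurable C₀ ?_
  filter_upwards [h.ae_le hk] with ω hω
  simpa using hω

lemma Setting.integrable_mul (h : Setting C₀ n X μ x) {k l : ℕ} (hk : k ∈ Finset.Icc 1 n)
    (hl : l ∈ Finset.Icc 1 n) : Integrable (fun ω => (X k ω : ℝ) * (X l ω : ℝ)) μ := by
  refine (h.integrable hk).mul_bdd (c := C₀) (h.measurable_comp _ hl).aestronglyMeasurable ?_
  filter_upwards [h.ae_le hl] with ω hω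
  simpa using hω

/-- The pointwise expansion has remainder `N (N - 1) / 2 * ‖u - 1‖ ^ 2`, and its coefficient
integrates to half the second factorial moment. -/
lemma Setting.norm_integral_pow_sub_le (h : Setting C₀ n X μ x) (hn : 1 ≤ n) {u : ℂ}
    (hu : ‖u‖ = 1) :
    ‖∫ ω, (u ^ X 1 ω - 1) ∂μ - nu1 X μ * (u - 1)‖ ≤ nu2 X μ / 2 * ‖u - 1‖ ^ 2 := by
  have h1 : 1 ∈ Finset.Icc 1 n := Finset.mem_Icc.2 ⟨le_rfl, hn⟩
  have hi : Integrable (fun ω => u ^ X 1 ω - 1) μ := by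
    refine Integrable.of_bound (h.measurable_comp (fun N => u ^ N - 1) h1).aestronglyMeasurable 2
      (ae_of_all _ fun ω => (norm_sub_le _ _).trans ?_)
    simp [hu]; norm_num
  have hi2 : Integrable (fun ω => ((X 1 ω : ℝ) : ℂ) * (u - 1)) μ :=
    (h.integrable h1).ofReal.mul_const _
  have hi3 : Integrable (fun ω => (X 1 ω : ℝ) * ((X 1 ω : ℝ) - 1)) μ := by
    simp only [mul_sub, mul_one]
    exact (h.integrable_mul h1 h1).sub (h.integrable h1)
  rw [nu1, nu2, ← integral_complex_ofReal, ← integral_mul_const, ← integral_sub hi hi2,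
    ← integral_div, ← integral_mul_const]
  refine norm_integral_le_of_norm_le ((hi3.div_const 2).mul_const _) (ae_of_all _ fun ω => ?_)
  simpa using (norm_pow_sub_one_sub_le hu (X 1 ω)).1

lemma Setting.integral_norm_pow_sub_one_le (h : Setting C₀ n X μ x) {u : ℂ}
    (hu : ‖u‖ = 1) {k : ℕ} (hk : k ∈ Finset.Icc 1 n) :
    ∫ ω, ‖u ^ X k ω - 1‖ ∂μ ≤ nu1 X μ * ‖u - 1‖ := by
  rw [nu1, ← h.integral_comp_eq (fun N => (N : ℝ)) hk, ← integral_mul_const]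
  exact integral_mono_of_nonneg (ae_of_all _ fun _ => norm_nonneg _)
    ((h.integrable hk).mul_const _) (ae_of_all _ fun ω => (norm_pow_sub_one_sub_le hu (X k ω)).2)

lemma Setting.integral_norm_mul_norm_le (h : Setting C₀ n X μ x) {u : ℂ}
    (hu : ‖u‖ = 1) {k : ℕ} (hk : k ∈ Finset.Ico 1 n) :
    ∫ ω, ‖u ^ X k ω - 1‖ * ‖u ^ X (k + 1) ω - 1‖ ∂μ ≤ nu11 n X μ * ‖u - 1‖ ^ 2 := by
  have hk' := Finset.mem_Ico.1 hk
  have h1 : k ∈ Finset.Icc 1 n := Finset.mem_Icc.2 ⟨hk'.1, hk'.2.le⟩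
  have h2 : k + 1 ∈ Finset.Icc 1 n := Finset.mem_Icc.2 ⟨by omega, hk'.2⟩
  refine le_trans ?_ (mul_le_mul_of_nonneg_right (integral_mul_le_nu11 hk) (sq_nonneg _))
  rw [← integral_mul_const]
  refine integral_mono_of_nonneg
    (ae_of_all _ fun _ => mul_nonneg (norm_nonneg _) (norm_nonneg _))
    ((h.integrable_mul h1 h2).mul_const _) (ae_of_all _ fun ω => ?_)
  calc _ ≤ ((X k ω : ℝ) * ‖u - 1‖) * ((X (k + 1) ω : ℝ) * ‖u - 1‖) :=
        mul_le_mul (norm_pow_sub_one_sub_le hu _).2 (norm_pow_sub_one_sub_le hu _).2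
          (norm_nonneg _) (by positivity)
    _ = _ := by ring

/-- The one-step estimate for the generating function on the unit circle. -/
lemma Setting.norm_step_le (h : Setting C₀ n X μ x) (hn : 1 ≤ n) (hν : nu1 X μ ≤ 1 / 64)
    (hG : maxMoment n X μ ≤ 1 / 1024) {u : ℂ} (hu : ‖u‖ = 1) {j : ℕ} (hj : j < n) :
    ‖∫ ω, ∏ i ∈ Finset.Icc 1 (j + 1), u ^ X i ω ∂μ -
        Complex.exp (nu1 X μ * (u - 1)) * ∫ ω, ∏ i ∈ Finset.Icc 1 j, u ^ X i ω ∂μ‖ ≤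
      134 * maxMoment n X μ * ‖u - 1‖ ^ 2 * ‖∫ ω, ∏ i ∈ Finset.Icc 1 j, u ^ X i ω ∂μ‖ := by
  set ν := nu1 X μ with hνdef
  set G := maxMoment n X μ with hGdef
  set s := ‖u - 1‖ with hs
  have hν0 : 0 ≤ ν := nu1_nonneg
  have hG0 : 0 ≤ G := maxMoment_nonneg
  have hs0 : 0 ≤ s := norm_nonneg _
  have hs2 : s ≤ 2 := (norm_sub_le _ _).trans (by simp [hu]; norm_num)
  have hGν : ν ^ 2 ≤ G := le_max_left _ _
  have hG2 : nu2 X μ ≤ G := (le_max_left _ _).trans (le_max_right _ _)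
  have hG11 : nu11 n X μ ≤ G := (le_max_right _ _).trans (le_max_right _ _)
  have hss : s ^ 2 ≤ 4 := by nlinarith
  have hνs : ν * s ≤ 1 / 32 := by nlinarith
  have hf : ∀ N : ℕ, ‖u ^ N‖ ≤ 1 := fun N => by simp [hu]
  have hf1 : ∀ N : ℕ, ‖u ^ N - 1‖ ≤ 2 := fun N =>
    (norm_sub_le _ _).trans (by simp [hu]; norm_num)
  set w₀ := ∫ ω, (u ^ X 1 ω - 1) ∂μ with hw₀def
  have hone : 1 ∈ Finset.Icc 1 n := Finset.mem_Icc.2 ⟨le_rfl, hn⟩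
  have hw₀ : ‖w₀‖ ≤ ν * s :=
    (norm_integral_le_integral_norm _).trans (h.integral_norm_pow_sub_one_le hu hone)
  -- The index of `F` is shifted by one so that truncation gives `F 0 = F 1 = 1`. The choice of `b`
  -- satisfies `8 * a ^ 2 ≤ b` because `ν ^ 2 ≤ G`, and it also dominates the neighbour moment.
  have key := norm_recursion_sub_le
    (F := fun m => ∫ ω, ∏ i ∈ Finset.Icc 1 (m - 1), u ^ X i ω ∂μ)
    (w := fun m k => ∫ ω, ∏ i ∈ Finset.Icc (m + 1) k, (u ^ X i ω - 1) ∂μ)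
    (n := n) (a := ν * s) (b := 8 * G * s ^ 2) (w₀ := w₀) (by positivity) (by nlinarith) (by simp)
    (fun j hj => integral_prod_succ h.oneDependent h.measurable (fun N => u ^ N) hf hj) hw₀
    (fun j hj => by
      simpa using h.integral_comp_eq (fun N => u ^ N - 1)
        (Finset.mem_Icc.2 ⟨by omega, hj⟩ : j + 1 ∈ Finset.Icc 1 n))
    (fun m i him => by
      refine (norm_integral_le_integral_norm _).trans ?_
      simp only [norm_prod]
      refine integral_prod_le_geometric h.oneDependent h.measurable (fun N => ‖u ^ N - 1‖)
        (fun _ => norm_nonneg _) hf1 hνs (by nlinarith [sq_nonneg s])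
        (fun k hk => h.integral_norm_pow_sub_one_le hu hk)
        (fun k hk => (h.integral_norm_mul_norm_le hu hk).trans ?_) i m him
      nlinarith [sq_nonneg s])
    j hj
  simp only [Nat.add_sub_cancel, show j + 2 - 1 = j + 1 by omega] at key
  have hexp : ‖Complex.exp (ν * (u - 1)) - 1 - ν * (u - 1)‖ ≤ (ν * s) ^ 2 := by
    have e : ‖(ν : ℂ) * (u - 1)‖ = ν * s := by
      rw [norm_mul, Complex.norm_real, Real.norm_of_nonneg hν0]
    rw [← e]
    exact Complex.norm_exp_sub_one_sub_id_le (by rw [e]; linarith)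
  have hw1 := h.norm_integral_pow_sub_le hn hu
  set P := ∫ ω, ∏ i ∈ Finset.Icc 1 j, u ^ X i ω ∂μ
  set Q := ∫ ω, ∏ i ∈ Finset.Icc 1 (j + 1), u ^ X i ω ∂μ
  have hdiff : ‖(1 + w₀) - Complex.exp (ν * (u - 1))‖ ≤ 2 * G * s ^ 2 := by
    calc _ = ‖(w₀ - ν * (u - 1)) - (Complex.exp (ν * (u - 1)) - 1 - ν * (u - 1))‖ := by
          congr 1; ring
      _ ≤ nu2 X μ / 2 * s ^ 2 + (ν * s) ^ 2 := (norm_sub_le _ _).trans (add_le_add hw1 hexp)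
      _ ≤ _ := by nlinarith [sq_nonneg s]
  calc ‖Q - Complex.exp (ν * (u - 1)) * P‖
      = ‖(Q - (1 + w₀) * P) + ((1 + w₀) - Complex.exp (ν * (u - 1))) * P‖ := by congr 1; ring
    _ ≤ (2 * (ν * s) * (2 * (ν * s) + 8 * (8 * G * s ^ 2)) + 8 * (8 * G * s ^ 2)) * ‖P‖ +
        2 * G * s ^ 2 * ‖P‖ := by
        refine (norm_add_le _ _).trans ?_
        rw [norm_mul]
        gcongr
    -- The terms contribute at most `4 + 4 + 64 + 2 = 74` times `G * s ^ 2`, so the constant leaves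
    -- room.
    _ ≤ 134 * G * s ^ 2 * ‖P‖ := by
        rw [← add_mul]
        refine mul_le_mul_of_nonneg_right ?_ (norm_nonneg _)
        have h1 : ν ^ 2 * s ^ 2 ≤ G * s ^ 2 := by gcongr
        have h2 : (ν * s) * (G * s ^ 2) ≤ 1 / 32 * (G * s ^ 2) := by gcongr
        have h3 : 0 ≤ G * s ^ 2 := by positivity
        nlinarith

/-- The norm is `exp (ν (Re u - 1))`, and `‖u - 1‖ ^ 2 = 2 - 2 Re u` on the unit circle. -/
lemma norm_exp_mul_sub_one {u : ℂ} (hu : ‖u‖ = 1) (ν : ℝ) :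
    ‖Complex.exp (ν * (u - 1))‖ = Real.exp (-(ν * ‖u - 1‖ ^ 2 / 2)) := by
  rw [Complex.norm_exp]
  congr 1
  have h1 : u.re ^ 2 + u.im ^ 2 = 1 := by
    have := Complex.sq_norm u
    rw [hu, Complex.normSq_apply] at this
    linarith
  rw [Complex.sq_norm, Complex.normSq_apply]
  simp
  linear_combination ν / 2 * h1

/-- On the unit circle the generating function of the sum is close to the Poisson one. -/
theorem Setting.norm_genFun_sub_le (h : Setting C₀ n X μ x) (hn : 1 ≤ n) (hν0 : 0 < nu1 X μ)
    (hν : nu1 X μ ≤ 1 / 64) (hG : 1072 * maxMoment n X μ ≤ nu1 X μ) {u : ℂ} (hu : ‖u‖ = 1) :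
    ‖∫ ω, ∏ i ∈ Finset.Icc 1 n, u ^ X i ω ∂μ - Complex.exp (n * nu1 X μ * (u - 1))‖ ≤
      2144 * (maxMoment n X μ / nu1 X μ) * Real.exp (-(n * nu1 X μ * ‖u - 1‖ ^ 2 / 8)) := by
  have hG0 : 0 ≤ maxMoment n X μ := maxMoment_nonneg
  have hs2 : ‖u - 1‖ ≤ 2 := (norm_sub_le _ _).trans (by simp [hu]; norm_num)
  have hstep := fun j (hj : j < n) => h.norm_step_le hn hν (by linarith) hu hj
  have hρ := norm_exp_mul_sub_one hu (nu1 X μ)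
  generalize nu1 X μ = ν at *
  generalize maxMoment n X μ = G at *
  set s := ‖u - 1‖ ^ 2 with hs
  have hs0 : 0 ≤ s := sq_nonneg _
  have hs4 : s ≤ 4 := by rw [hs]; nlinarith [norm_nonneg (u - 1)]
  have hv0 : 0 ≤ ν * s := by positivity
  have hv1 : ν * s ≤ 1 / 16 := by nlinarith
  have hR : ‖Complex.exp (ν * (u - 1))‖ + 134 * G * s ≤ Real.exp (-(ν * s / 4)) := by
    rw [hρ]
    have h1 : Real.exp (-(ν * s / 4)) = Real.exp (-(ν * s / 2)) * Real.exp (ν * s / 4) := by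
      rw [← Real.exp_add]; congr 1; ring
    have h2 := Real.add_one_le_exp (ν * s / 4)
    have h3 := Real.add_one_le_exp (-(ν * s / 2))
    -- Here `1072 = 8 * 134`. The error thus uses up at most half of the exponent `ν * s / 2`, where
    -- `s` now denotes the square of `‖u - 1‖`.
    have h4 : 134 * G * s ≤ ν * s / 8 := by nlinarith
    rw [h1]
    calc Real.exp (-(ν * s / 2)) + 134 * G * s
        ≤ Real.exp (-(ν * s / 2)) + Real.exp (-(ν * s / 2)) * (ν * s / 4) := by
          refine add_le_add_right (h4.trans ?_) _
          nlinarith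
      _ = Real.exp (-(ν * s / 2)) * (ν * s / 4 + 1) := by ring
      _ ≤ _ := by gcongr
  have key := norm_sub_pow_le
    (F := fun m => ∫ ω, ∏ i ∈ Finset.Icc 1 (m - 1), u ^ X i ω ∂μ) (n := n)
    (r := Complex.exp (ν * (u - 1))) (by positivity) hR (by simp) hstep
  rw [← Complex.exp_nat_mul] at key
  simp only [Nat.add_sub_cancel, ← mul_assoc] at key
  refine key.trans ?_
  have hL : 0 < n * ν := by have : (0 : ℝ) < n := by exact_mod_cast hn
                            positivity
  -- The power is split into two equal Gaussian factors and a bounded correction for the exponent `n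
  -- - 1`. One Gaussian factor absorbs `n * ν * s / 8`, the other survives; `2144 = 134 * 2 * 8`.
  have e1 : Real.exp (-(ν * s / 4)) ^ (n - 1) =
      Real.exp (-(n * ν * s / 8)) * Real.exp (-(n * ν * s / 8)) * Real.exp (ν * s / 4) := by
    rw [← Real.exp_nat_mul, ← Real.exp_add, ← Real.exp_add, Nat.cast_sub hn]
    congr 1; push_cast; ring
  have e2 : Real.exp (ν * s / 4) ≤ 2 := by
    have := Real.exp_one_lt_d9
    have h5 : Real.exp (ν * s / 4) ≤ Real.exp (1 / 2) := Real.exp_le_exp.2 (by linarith)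
    have h6 : Real.exp (1 / 2) * Real.exp (1 / 2) = Real.exp 1 := by
      rw [← Real.exp_add]; norm_num
    nlinarith [Real.exp_pos (1 / 2)]
  have e3 : n * ν * s / 8 * Real.exp (-(n * ν * s / 8)) ≤ 1 := by
    have := Real.add_one_le_exp (n * ν * s / 8)
    rw [Real.exp_neg, ← div_eq_mul_inv, div_le_one (Real.exp_pos _)]
    linarith
  rw [e1]
  have hE := Real.exp_pos (-(n * ν * s / 8))
  generalize Real.exp (-(n * ν * s / 8)) = E at *
  calc n * 134 * G * s * (E * E * Real.exp (ν * s / 4))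
      ≤ n * 134 * G * s * (E * E * 2) := by gcongr
    _ = 2144 * (G / ν) * E * (n * ν * s / 8 * E) := by field_simp; ring
    _ ≤ 2144 * (G / ν) * E * 1 := by gcongr
    _ = _ := mul_one _

end Moments

/-! ### Fourier inversion and the local estimate -/

lemma integral_exp_int_mul (k : ℤ) :
    ∫ t in -Real.pi..Real.pi, Complex.exp (k * Complex.I * t) =
      if k = 0 then (2 * Real.pi : ℂ) else 0 := by
  split_ifs with hk
  · simp [hk, two_mul]
  · have hc : (k : ℂ) * Complex.I ≠ 0 :=
      mul_ne_zero (Int.cast_ne_zero.2 hk) Complex.I_ne_zero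
    rw [integral_exp_mul_complex hc, div_eq_zero_iff]
    left
    rw [sub_eq_zero, Complex.exp_eq_exp_iff_exists_int]
    exact ⟨k, by push_cast; ring⟩

/-- Fourier inversion for random variables with values in the natural numbers. -/
theorem integral_exp_mul_genFun {Ω : Type*} [MeasurableSpace Ω] {μ : Measure Ω}
    [IsProbabilityMeasure μ] {S : Ω → ℕ} (hS : Measurable S) (x : ℕ) :
    ∫ t in -Real.pi..Real.pi, Complex.exp (-(x * Complex.I * t)) *
        ∫ ω, Complex.exp (t * Complex.I) ^ S ω ∂μ =
      2 * Real.pi * μ.real {ω | S ω = x} := by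
  have hswap : ∀ t : ℝ, Complex.exp (-(x * Complex.I * t)) *
      ∫ ω, Complex.exp (t * Complex.I) ^ S ω ∂μ =
      ∫ ω, Complex.exp (((S ω : ℤ) - (x : ℤ) : ℤ) * Complex.I * t) ∂μ := by
    intro t
    rw [← integral_const_mul]
    congr 1
    ext ω
    rw [← Complex.exp_nat_mul, ← Complex.exp_add]
    congr 1
    push_cast
    ring
  simp_rw [hswap]
  -- After Fubini, orthogonality of the characters leaves `2π` times the indicator of `S = x`.
  rw [intervalIntegral_integral_swap]
  · simp_rw [integral_exp_int_mul]
    have e : ∀ ω, (if (S ω : ℤ) - (x : ℤ) = 0 then (2 * Real.pi : ℂ) else 0) =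
        Set.indicator {ω | S ω = x} (fun _ => (2 * Real.pi : ℂ)) ω := by
      intro ω
      by_cases hω : S ω = x
      · simp [hω]
      · rw [if_neg (by omega), Set.indicator_of_notMem (by simpa using hω)]
    simp_rw [e]
    rw [integral_indicator (measurableSet_eq_fun hS measurable_const), setIntegral_const]
    simp [mul_comm]
  · rw [Set.uIoc_of_le (by linarith [Real.pi_pos])]
    refine Integrable.of_bound (C := 1) ?_ (ae_of_all _ fun p => ?_)
    · have : Measurable fun p : ℝ × Ω => ((S p.2 : ℕ) : ℂ) :=
        (measurable_from_top (f := fun N : ℕ => (N : ℂ))).comp (hS.comp measurable_snd)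
      simp only [Function.uncurry_def]
      push_cast
      exact Measurable.aestronglyMeasurable (by fun_prop)
    · rw [Function.uncurry_def, Complex.norm_exp]
      simp

lemma integral_pow_poissonMeasure (r : NNReal) (t : ℝ) :
    ∫ N, Complex.exp (t * Complex.I) ^ N ∂(poissonMeasure r) =
      Complex.exp (r * (Complex.exp (t * Complex.I) - 1)) := by
  rw [← charFun_map_cast_poissonMeasure, charFun_apply,
    integral_map .of_discrete (by fun_prop)]
  congr 1
  ext N
  rw [← Complex.exp_nat_mul, Real.inner_apply]
  congr 1
  push_cast
  ring

/-- The right side is `2 (1 - cos t)`, and `cos t ≤ 1 - 2 t² / π²` on `[-π, π]`. This converts decay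
in `‖u - 1‖` into Gaussian decay in `t`. -/
lemma sq_mul_four_le_norm_exp_sub_one_sq {t : ℝ} (ht : |t| ≤ Real.pi) :
    4 / Real.pi ^ 2 * t ^ 2 ≤ ‖Complex.exp (t * Complex.I) - 1‖ ^ 2 := by
  have h1 := Real.cos_le_one_sub_mul_cos_sq ht
  have h2 := Real.sin_sq_add_cos_sq t
  rw [Complex.sq_norm, Complex.normSq_apply]
  simp only [Complex.sub_re, Complex.sub_im, Complex.exp_ofReal_mul_I_re,
    Complex.exp_ofReal_mul_I_im, Complex.one_re, Complex.one_im]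
  have e : 4 / Real.pi ^ 2 * t ^ 2 = 2 * (2 / Real.pi ^ 2 * t ^ 2) := by ring
  nlinarith

lemma integral_exp_neg_mul_sq_le {c : ℝ} (hc : 0 < c) :
    ∫ t in -Real.pi..Real.pi, Real.exp (-c * t ^ 2) ≤ √(Real.pi / c) := by
  rw [← integral_gaussian, intervalIntegral.integral_of_le (by linarith [Real.pi_pos])]
  exact setIntegral_le_integral (integrable_exp_neg_mul_sq hc)
    (ae_of_all _ fun _ => (Real.exp_pos _).le)

/-- The local limit estimate: the point probabilities of the sum and of the Poisson variable
differ by `O((max(ν₁², ν₂, ν₁₁) / ν₁) / √(n ν₁))`. -/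
theorem Setting.abs_probSum_sub_probPoisson_le {Ω : Type*} [MeasurableSpace Ω] {μ : Measure Ω}
    [IsProbabilityMeasure μ] {n : ℕ} {X : ℕ → Ω → ℕ} {C₀ : ℝ} {x : ℕ} (h : Setting C₀ n X μ x)
    (hn : 1 ≤ n) (hν0 : 0 < nu1 X μ) (hν : nu1 X μ ≤ 1 / 64)
    (hG : 1072 * maxMoment n X μ ≤ nu1 X μ) :
    |probSum n X μ x - probPoisson n X μ x| ≤
      2144 * √(2 * Real.pi ^ 3) * (maxMoment n X μ / nu1 X μ) / √(n * nu1 X μ) := by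
  have hS : Measurable fun ω => ∑ k ∈ Finset.Icc 1 n, X k ω :=
    Finset.measurable_fun_sum _ h.measurable
  have hn0 : (0 : ℝ) < n := by exact_mod_cast hn
  have hL : 0 < n * nu1 X μ := by positivity
  have hG0 : 0 ≤ maxMoment n X μ := maxMoment_nonneg
  have h1 := integral_exp_mul_genFun (μ := μ) hS x
  have h2 := integral_exp_mul_genFun (μ := poissonMeasure (n * nu1 X μ).toNNReal)
    (S := fun N => N) measurable_id x
  simp only [← Finset.prod_pow_eq_pow_sum] at h1
  simp only [integral_pow_poissonMeasure, Real.coe_toNNReal _ hL.le, Set.ofPred_eq_eq_singleton]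
    at h2
  -- The Gaussian rate is the product of `n ν₁ / 8` from the generating function bound and `4 / π²`
  -- from the chord estimate.
  set c := n * nu1 X μ / (2 * Real.pi ^ 2) with hc
  have hc0 : 0 < c := by positivity
  set f : ℝ → ℂ := fun t => Complex.exp (-(x * Complex.I * t)) *
    ∫ ω, ∏ i ∈ Finset.Icc 1 n, Complex.exp (t * Complex.I) ^ X i ω ∂μ with hf
  set g : ℝ → ℂ := fun t => Complex.exp (-(x * Complex.I * t)) *
    Complex.exp ((n * nu1 X μ : ℝ) * (Complex.exp (t * Complex.I) - 1)) with hg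
  have hfi : IntervalIntegrable f volume (-Real.pi) Real.pi := by
    refine Continuous.intervalIntegrable ?_ _ _
    refine Continuous.mul (by fun_prop) ?_
    refine continuous_of_dominated (bound := fun _ => 1) (fun t => ?_)
      (fun t => ae_of_all _ fun ω => ?_) (integrable_const _)
      (ae_of_all _ fun ω => by fun_prop)
    · exact (measurable_prod_block h.measurable (fun N => Complex.exp (t * Complex.I) ^ N)
        le_rfl le_rfl).aestronglyMeasurable
    · simp [norm_prod, Complex.norm_exp_ofReal_mul_I]
  have hgi : IntervalIntegrable g volume (-Real.pi) Real.pi :=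
    Continuous.intervalIntegrable (by fun_prop) _ _
  have hbound : ‖∫ t in -Real.pi..Real.pi, (f t - g t)‖ ≤
      2144 * (maxMoment n X μ / nu1 X μ) * √(Real.pi / c) := by
    have hpi := Real.pi_pos
    calc _ ≤ ∫ t in -Real.pi..Real.pi,
          2144 * (maxMoment n X μ / nu1 X μ) * Real.exp (-c * t ^ 2) := by
          refine intervalIntegral.norm_integral_le_of_norm_le (by linarith)
            (ae_of_all _ fun t ht => ?_)
            (Continuous.intervalIntegrable (by fun_prop) _ _)
          have hu : ‖Complex.exp (t * Complex.I)‖ = 1 := Complex.norm_exp_ofReal_mul_I t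
          have k1 := h.norm_genFun_sub_le hn hν0 hν hG hu
          have k2 := sq_mul_four_le_norm_exp_sub_one_sq (abs_le.2 ⟨ht.1.le, ht.2⟩)
          have k3 : ‖Complex.exp (-(x * Complex.I * t))‖ = 1 := by
            rw [Complex.norm_exp]; simp
          rw [hf, hg, ← mul_sub, norm_mul, k3, one_mul]
          push_cast
          refine k1.trans ?_
          gcongr
          rw [neg_mul, neg_le_neg_iff, hc]
          calc n * nu1 X μ / (2 * Real.pi ^ 2) * t ^ 2
              = n * nu1 X μ / 8 * (4 / Real.pi ^ 2 * t ^ 2) := by field_simp; ring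
            _ ≤ n * nu1 X μ / 8 * ‖Complex.exp (t * Complex.I) - 1‖ ^ 2 := by gcongr
            _ = _ := by ring
      _ ≤ _ := by
          rw [intervalIntegral.integral_const_mul]
          gcongr
          exact integral_exp_neg_mul_sq_le hc0
  rw [intervalIntegral.integral_sub hfi hgi, h1, h2, ← mul_sub, ← Complex.ofReal_sub, norm_mul,
    Complex.norm_real, Real.norm_eq_abs] at hbound
  have e1 : ‖(2 * Real.pi : ℂ)‖ = 2 * Real.pi := by
    simp [abs_of_pos Real.pi_pos]
  have e2 : √(Real.pi / c) = √(2 * Real.pi ^ 3) / √(n * nu1 X μ) := by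
    rw [← Real.sqrt_div (by positivity), hc]
    congr 1
    field_simp
  rw [e1, e2] at hbound
  calc _ ≤ 2 * Real.pi * |probSum n X μ x - probPoisson n X μ x| :=
        le_mul_of_one_le_left (abs_nonneg _) (by linarith [Real.pi_gt_three])
    _ ≤ _ := hbound
    _ = _ := by ring

/-! ### Lower bound for Poisson point probabilities -/

/-- The Stirling sequence `k! / (√(2k) (k / e)^k)` decreases from its value `e / √2` at `k = 1`. -/
lemma factorial_le_exp_one_mul_sqrt {x : ℕ} (hx : 0 < x) :
    (x.factorial : ℝ) ≤ Real.exp 1 * √x * (x / Real.exp 1) ^ x := by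
  obtain ⟨k, rfl⟩ := Nat.exists_eq_succ_of_ne_zero hx.ne'
  have h1 := Stirling.stirlingSeq'_antitone (Nat.zero_le k)
  simp only [Function.comp, Nat.succ_eq_add_one, zero_add, Stirling.stirlingSeq_one] at h1
  rw [Stirling.stirlingSeq, div_le_iff₀ (by positivity)] at h1
  refine h1.trans_eq ?_
  rw [Real.sqrt_mul (by norm_num)]
  field_simp

/-- A Poisson variable of mean `L` takes values within `√L` of its mean with probability at least
of order `1 / √L`. -/
theorem le_poissonMeasure_real_singleton {L : ℝ} (hL : 0 < L) {x : ℕ} (hx : 0 < x)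
    (hdev : ((x : ℝ) - L) ^ 2 ≤ L) (hx4 : (x : ℝ) ≤ 4 * L) :
    Real.exp (-2) / 2 / √L ≤ (poissonMeasure L.toNNReal).real {x} := by
  rw [poissonMeasure_real_singleton, Real.coe_toNNReal _ hL.le]
  have hx0 : (0 : ℝ) < x := by exact_mod_cast hx
  have hs : √(x : ℝ) ≤ 2 * √L := by
    refine (Real.sqrt_le_sqrt hx4).trans_eq ?_
    rw [Real.sqrt_mul (by norm_num), show (4 : ℝ) = 2 ^ 2 by norm_num,
      Real.sqrt_sq (by norm_num)]
  -- From `z ≤ exp (z - 1)` with `z = x / L`, the exponent is `x (x / L - 1) = (x - L)² / L + x -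
  -- L`, and `hdev` bounds its quadratic part by `1`. This costs one factor `e`; the factorial bound
  -- costs another.
  have hpow : Real.exp (-1) * (x / Real.exp 1) ^ x ≤ Real.exp (-L) * L ^ x := by
    have e1 : (x / Real.exp 1) ^ x = (x / L) ^ x * L ^ x * Real.exp (-x) := by
      rw [← mul_pow, div_mul_cancel₀ _ hL.ne', div_pow, Real.exp_neg, div_eq_mul_inv,
        ← Real.exp_nat_mul, mul_one]
    have e2 : (x / L) ^ x ≤ Real.exp (x * (x / L - 1)) := by
      rw [Real.exp_nat_mul]
      gcongr
      have := Real.add_one_le_exp (x / L - 1)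
      linarith
    have e3 : (x : ℝ) * (x / L - 1) ≤ 1 + x - L := by
      have : (x : ℝ) * (x / L - 1) = (x - L) ^ 2 / L + x - L := by field_simp; ring
      rw [this]
      have := (div_le_one hL).2 hdev
      linarith
    calc _ = Real.exp (-1) * Real.exp (-x) * (x / L) ^ x * L ^ x := by rw [e1]; ring
      _ ≤ Real.exp (-1) * Real.exp (-x) * Real.exp (1 + x - L) * L ^ x := by
          gcongr
          exact e2.trans (Real.exp_le_exp.2 e3)
      _ = _ := by rw [← Real.exp_add, ← Real.exp_add]; congr 2; ring
  have hfac := factorial_le_exp_one_mul_sqrt hx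
  rw [le_div_iff₀ (by positivity)]
  calc _ ≤ Real.exp (-2) / 2 / √L * (Real.exp 1 * √x * (x / Real.exp 1) ^ x) := by gcongr
    _ ≤ Real.exp (-2) / 2 / √L * (Real.exp 1 * (2 * √L) * (x / Real.exp 1) ^ x) := by gcongr
    _ = Real.exp (-1) * (x / Real.exp 1) ^ x := by
        rw [show (-1 : ℝ) = -2 + 1 by norm_num, Real.exp_add]
        have : √L ≠ 0 := (Real.sqrt_pos.2 hL).ne'
        field_simp
    _ ≤ _ := hpow

end LocalPoisson

/-! ### The limit of the ratio -/

theorem corollary1 {Ω : ℕ → Type*} [∀ n, MeasurableSpace (Ω n)]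
    (μ : ∀ n, Measure (Ω n)) [∀ n, IsProbabilityMeasure (μ n)]
    (X : ∀ n, ℕ → Ω n → ℕ) (x : ℕ → ℕ) (C₀ : ℝ) (hC₀ : 1 ≤ C₀)
    (hsetting : ∀ᶠ n in atTop, LocalPoisson.Setting C₀ n (X n) (μ n) (x n))
    (hx : (fun n : ℕ => (x n : ℝ) - n * LocalPoisson.nu1 (X n) (μ n))
      =o[atTop] fun n : ℕ => √(n * LocalPoisson.nu1 (X n) (μ n)))
    (hgam : (fun n : ℕ => LocalPoisson.gam C₀ n (X n) (μ n))
      =o[atTop] fun n : ℕ => LocalPoisson.nu1 (X n) (μ n))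
    (hnu : Tendsto (fun n : ℕ => LocalPoisson.nu1 (X n) (μ n)) atTop (𝓝 0))
    (hmean : Tendsto (fun n : ℕ => (n : ℝ) * LocalPoisson.nu1 (X n) (μ n)) atTop atTop) :
    Tendsto (fun n : ℕ => LocalPoisson.probSum n (X n) (μ n) (x n)
      / LocalPoisson.probPoisson n (X n) (μ n) (x n)) atTop (𝓝 1) := by
  -- The factor `exp (1.5 * C₀)` in `gam` is at least `1`, so it may be dropped.
  have hmax : (fun n : ℕ => LocalPoisson.maxMoment n (X n) (μ n))
      =o[atTop] fun n : ℕ => LocalPoisson.nu1 (X n) (μ n) := by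
    refine IsBigO.trans_isLittleO (IsBigO.of_bound 1 (Eventually.of_forall fun n => ?_)) hgam
    have h0 : 0 ≤ LocalPoisson.maxMoment n (X n) (μ n) := LocalPoisson.maxMoment_nonneg
    have h1 : 1 ≤ Real.exp (1.5 * C₀) := Real.one_le_exp (by positivity)
    change ‖LocalPoisson.maxMoment n (X n) (μ n)‖ ≤
      1 * ‖Real.exp (1.5 * C₀) * LocalPoisson.maxMoment n (X n) (μ n)‖
    rw [one_mul, norm_mul, Real.norm_of_nonneg (Real.exp_pos _).le]
    exact le_mul_of_one_le_left (norm_nonneg _) h1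
  have hratio := hmax.tendsto_div_nhds_zero
  rw [tendsto_iff_norm_sub_tendsto_zero]
  refine squeeze_zero' (Eventually.of_forall fun _ => norm_nonneg _) ?_
    (by
      simpa only [mul_zero] using
        hratio.const_mul (2144 * √(2 * Real.pi ^ 3) / (Real.exp (-2) / 2)))
  filter_upwards [hsetting, hx.bound one_pos, hmax.bound (show (0 : ℝ) < 1 / 1072 by norm_num),
    hnu.eventually_le_const (show (0 : ℝ) < 1 / 64 by norm_num), hmean.eventually_ge_atTop 1,
    eventually_ge_atTop 1] with n hS hxn hGn hνn hLn hn
  have hL : 0 < n * LocalPoisson.nu1 (X n) (μ n) := by linarith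
  have hν0 : 0 < LocalPoisson.nu1 (X n) (μ n) := pos_of_mul_pos_right hL (Nat.cast_nonneg n)
  rw [Real.norm_of_nonneg LocalPoisson.maxMoment_nonneg, Real.norm_of_nonneg hν0.le] at hGn
  have hdiff := hS.abs_probSum_sub_probPoisson_le hn hν0 hνn (by linarith)
  rw [one_mul, Real.norm_eq_abs, Real.norm_of_nonneg (Real.sqrt_nonneg _)] at hxn
  have hdev : ((x n : ℝ) - n * LocalPoisson.nu1 (X n) (μ n)) ^ 2 ≤
      n * LocalPoisson.nu1 (X n) (μ n) := by
    rw [← sq_abs]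
    calc _ ≤ √(n * LocalPoisson.nu1 (X n) (μ n)) ^ 2 := by gcongr
      _ = _ := Real.sq_sqrt hL.le
  -- Since the mean is at least `1`, a deviation of at most its square root is at most the mean
  -- itself.
  have hx4 : (x n : ℝ) ≤ 4 * (n * LocalPoisson.nu1 (X n) (μ n)) := by nlinarith
  have hlow := LocalPoisson.le_poissonMeasure_real_singleton hL hS.x_pos hdev hx4
  change _ ≤ LocalPoisson.probPoisson n (X n) (μ n) (x n) at hlow
  have hsq := Real.sqrt_pos.2 hL
  have hP : 0 < LocalPoisson.probPoisson n (X n) (μ n) (x n) :=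
    lt_of_lt_of_le (by positivity) hlow
  have hG0 : 0 ≤ LocalPoisson.maxMoment n (X n) (μ n) := LocalPoisson.maxMoment_nonneg
  rw [div_sub_one hP.ne', norm_div, Real.norm_eq_abs, Real.norm_of_nonneg hP.le, div_le_iff₀ hP]
  refine hdiff.trans ?_
  -- The factor `1 / √(n ν₁)` of the local estimate is exactly matched by the Poisson lower bound.
  calc _ = 2144 * √(2 * Real.pi ^ 3) / (Real.exp (-2) / 2) *
        (LocalPoisson.maxMoment n (X n) (μ n) / LocalPoisson.nu1 (X n) (μ n)) *
        (Real.exp (-2) / 2 / √(n * LocalPoisson.nu1 (X n) (μ n))) := by field_simp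
    _ ≤ _ := by gcongr
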